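/- Let $\mathsf{Loc}$ be the category of locales: its objects are the frames (complete lattices $L$ with $a\wedge\bigvee B=\bigvee_{b\in B}(a\wedge b)$ for all $a\in L$, $B\subseteq L$), and a morphism $f\colon L\to M$ is a localic map, i.e. a map preserving all meets whose left adjoint $f^*\colon M\to L$ preserves finite meets. For $a\in L$ let $\mathfrak c(a)=\{x\in L : a\le x\}$ be the closed sublocale induced by $a$; a localic map is closed if it sends every closed sublocale onto a closed sublocale. A locale $L$ is strongly Hausdorff if the diagonal $L\to L\times L$ into the product in $\mathsf{Loc}$ is closed, and compact if every $A\subseteq L$ with $\bigvee A=1$ has a finite subset $A_0\subseteq A$ with $\bigvee A_0=1$. Let $\mathsf{HLoc}$ be the full subcategory of $\mathsf{Loc}$ of strongly Hausdorff locales, $\mathsf{KHLoc}$ the full subcategory of $\mathsf{HLoc}$ of compact strongly Hausdorff locales, and $J\colon\mathsf{KHLoc}\to\mathsf{HLoc}$ the inclusion. If a functor $F\colon\mathcal A\to\mathcal B$ has a pointwise left Kan extension $(T,\eta)$ along itself, its density comonad is $(T,\epsilon,\delta)$, where $\epsilon\colon T\Rightarrow 1_{\mathcal B}$ and $\delta\colon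 T\Rightarrow T^2$ are the unique natural transformations with $\epsilon F\cdot\eta=1_F$ and $\delta F\cdot\eta=T\eta\cdot\eta$. A comonad is idempotent if its comultiplication $\delta$ is an isomorphism. A full subcategory $\mathcal W\subseteq\mathcal C$ is left Kan-extendable if its inclusion functor has a pointwise left Kan extension along itself and the resulting density comonad is idempotent. Proposition. The functor $J$ has a pointwise left Kan extension along itself, and its density comonad $T$ is idempotent. Hence $\mathsf{KHLoc}$ is a left Kan-extendable subcategory of $\mathsf{HLoc}$. -/

import Mathlib

open CategoryTheory CategoryTheory.Limits

universe u

noncomputable section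

/-! ### Density comonads and left Kan-extendable subcategories -/

namespace DensityComonad

variable {A B : Type*} [Category* A] [Category* B] {F : A ⥤ B}

/-- The counit `ε : T ⟶ 𝟭 B` of the density comonad of `F`, where `(T, η)` is a pointwise left Kan
extension of `F` along itself: the unique natural transformation with `εF ∘ η = 1_F`. -/
def counit (E : F.LeftExtension F) (hE : E.IsPointwiseLeftKanExtension) : E.right ⟶ 𝟭 B :=
  haveI := hE.isLeftKanExtension
  E.right.descOfIsLeftKanExtension E.hom (𝟭 B) F.rightUnitor.inv

/-- The comultiplication `δ : T ⟶ T²` of the density comonad of `F`: the unique natural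
transformation with `δF ∘ η = Tη ∘ η`. -/
def comul (E : F.LeftExtension F) (hE : E.IsPointwiseLeftKanExtension) :
    E.right ⟶ E.right ⋙ E.right :=
  haveI := hE.isLeftKanExtension
  E.right.descOfIsLeftKanExtension E.hom (E.right ⋙ E.right)
    (E.hom ≫ Functor.whiskerRight E.hom E.right)

theorem unit_counit (E : F.LeftExtension F) (hE : E.IsPointwiseLeftKanExtension) (X : A) :
    E.hom.app X ≫ (counit E hE).app (F.obj X) = 𝟙 (F.obj X) := by
  have := hE.isLeftKanExtension
  exact E.right.descOfIsLeftKanExtension_fac_app E.hom (𝟭 B) F.rightUnitor.inv X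

theorem unit_comul (E : F.LeftExtension F) (hE : E.IsPointwiseLeftKanExtension)
    (X : A) :
    E.hom.app X ≫ (comul E hE).app (F.obj X) =
      E.hom.app X ≫ E.right.map (E.hom.app X) := by
  have := hE.isLeftKanExtension
  exact E.right.descOfIsLeftKanExtension_fac_app E.hom (E.right ⋙ E.right)
    (E.hom ≫ Functor.whiskerRight E.hom E.right) X

theorem unit_counit_comp (E : F.LeftExtension F) (hE : E.IsPointwiseLeftKanExtension)
    (X : A) {Z : B} (h : F.obj X ⟶ Z) :
    E.hom.app X ≫ (counit E hE).app (F.obj X) ≫ h = h := by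
  have e := congrArg (· ≫ h) (unit_counit E hE X)
  simpa only [Category.assoc, Category.id_comp] using e

theorem unit_comul_comp (E : F.LeftExtension F) (hE : E.IsPointwiseLeftKanExtension)
    (X : A) {Z : B} (h : E.right.obj (E.right.obj (F.obj X)) ⟶ Z) :
    E.hom.app X ≫ (comul E hE).app (F.obj X) ≫ h =
      E.hom.app X ≫ E.right.map (E.hom.app X) ≫ h := by
  have e := congrArg (· ≫ h) (unit_comul E hE X)
  simpa only [Category.assoc] using e

theorem hom_ext (E : F.LeftExtension F) (hE : E.IsPointwiseLeftKanExtension) {G : B ⥤ B}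
    (α β : E.right ⟶ G)
    (h : ∀ X, E.hom.app X ≫ α.app (F.obj X) = E.hom.app X ≫ β.app (F.obj X)) : α = β := by
  have := hE.isLeftKanExtension
  refine E.right.hom_ext_of_isLeftKanExtension E.hom α β ?_
  ext X
  exact h X

end DensityComonad

open DensityComonad in
/-- The density comonad `(T, ε, δ)` of a functor `F` with a pointwise left Kan extension
`E = (T, η)` along itself. -/
def densityComonad {A B : Type*} [Category* A] [Category* B] (F : A ⥤ B)
    (E : F.LeftExtension F) (hE : E.IsPointwiseLeftKanExtension) : Comonad B where
  toFunctor := E.right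
  ε := counit E hE
  δ := comul E hE
  coassoc Y := by
    have h : comul E hE ≫ Functor.whiskerRight (comul E hE) E.right =
        comul E hE ≫ Functor.whiskerLeft E.right (comul E hE) := by
      refine hom_ext E hE (G := (E.right ⋙ E.right) ⋙ E.right) _ _ fun X => ?_
      have h₁ := (comul E hE).naturality (E.hom.app X)
      dsimp at h₁ ⊢
      rw [unit_comul_comp, unit_comul_comp, ← Functor.map_comp, unit_comul, h₁,
        unit_comul_comp, Functor.map_comp]
    exact congr_app h Y
  left_counit Y := by
    have h : comul E hE ≫ Functor.whiskerLeft E.right (counit E hE) = 𝟙 E.right := by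
      refine hom_ext E hE _ _ fun X => ?_
      have h₁ := (counit E hE).naturality (E.hom.app X)
      dsimp at h₁ ⊢
      rw [unit_comul_comp, h₁, unit_counit_comp]
      exact (Category.comp_id _).symm
    exact congr_app h Y
  right_counit Y := by
    have h : comul E hE ≫ Functor.whiskerRight (counit E hE) E.right = 𝟙 E.right := by
      refine hom_ext E hE _ _ fun X => ?_
      dsimp
      rw [unit_comul_comp, ← Functor.map_comp, unit_counit, CategoryTheory.Functor.map_id]
    exact congr_app h Y

/-- A comonad is idempotent if its comultiplication is an isomorphism. -/
def IsIdempotentComonad {C : Type*} [Category* C] (T : Comonad C) : Prop :=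
  IsIso T.δ

/-- A full subcategory `W` of `C` is left Kan-extendable if its inclusion functor has a pointwise
left Kan extension along itself, and its density comonad is idempotent. -/
structure IsLeftKanExtendable {C : Type*} [Category* C] (W : ObjectProperty C) : Prop where
  hasPointwiseLeftKanExtension : W.ι.HasPointwiseLeftKanExtension W.ι
  isIdempotent : ∀ (E : W.ι.LeftExtension W.ι) (hE : E.IsPointwiseLeftKanExtension),
    IsIdempotentComonad (densityComonad W.ι E hE)

/-! ### Compact and strongly Hausdorff locales -/

namespace Locale

/-- The frame homomorphism `f^* : M → L` of a morphism of locales `f : L ⟶ M`. -/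
def pullback {L M : Locale.{u}} (f : L ⟶ M) : FrameHom M L :=
  Frm.Hom.hom (Quiver.Hom.unop f)

/-- The localic map `f_* : L → M` of a morphism of locales `f : L ⟶ M`, that is, the right adjoint
of the frame homomorphism `f^*`. -/
def localicMap {L M : Locale.{u}} (f : L ⟶ M) (a : L) : M :=
  sSup {b : M | pullback f b ≤ a}

theorem gc_pullback_localicMap {L M : Locale.{u}} (f : L ⟶ M) :
    GaloisConnection (pullback f) (localicMap f) := by
  intro b a
  constructor
  · intro h
    exact le_sSup h
  · intro h
    refine (OrderHomClass.mono (pullback f) h).trans ?_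
    rw [localicMap, map_sSup]
    refine sSup_le ?_
    rintro _ ⟨c, hc, rfl⟩
    exact hc

/-- The closed sublocale `𝔠(a) = ↑a` of `L`. -/
def closedSublocale {L : Locale.{u}} (a : L) : Sublocale L where
  carrier := Set.Ici a
  sInf_mem' _ hs := le_sInf fun _ hx => hs hx
  himp_mem' _ _ hb := le_trans hb le_himp

/-- A morphism of locales is closed if the image of every closed sublocale under its localic map is
a closed sublocale. -/
def IsClosedMap {L M : Locale.{u}} (f : L ⟶ M) : Prop :=
  ∀ a : L, ∃ b : M, localicMap f '' (closedSublocale a : Set L) = (closedSublocale b : Set M)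

/-- A locale `L` is strongly Hausdorff if the diagonal `L ⟶ L × L` into the product in the category
of locales is closed. (Products are unique up to isomorphism, so it does not matter which product
cone `c` is used.) -/
def IsStronglyHausdorff : ObjectProperty Locale.{u} := fun L =>
  ∃ (c : BinaryFan L L) (hc : IsLimit c),
    IsClosedMap (BinaryFan.IsLimit.lift' hc (𝟙 L) (𝟙 L)).1

/-- A locale is compact if every cover of it has a finite subcover. -/
def IsCompact (L : Locale.{u}) : Prop :=
  ∀ A : Set L, sSup A = ⊤ → ∃ t ⊆ A, t.Finite ∧ sSup t = ⊤

end Locale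

/-- The category of strongly Hausdorff locales, a full subcategory of the category of locales. -/
abbrev HLoc : Type (u + 1) := Locale.IsStronglyHausdorff.{u}.FullSubcategory

/-- The full subcategory of `HLoc` given by the compact strongly Hausdorff locales. -/
def isCompactHLoc : ObjectProperty HLoc.{u} := fun L => Locale.IsCompact L.obj

/-- The category of compact strongly Hausdorff locales. -/
abbrev KHLoc : Type (u + 1) := isCompactHLoc.{u}.FullSubcategory

/-- The inclusion functor from compact strongly Hausdorff locales to strongly Hausdorff locales. -/
abbrev inclusionKHLoc : KHLoc.{u} ⥤ HLoc.{u} := isCompactHLoc.ι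

end

/-! ### Frames -/

section Frames

open Order

variable {L M N : Type*} [Frame L] [Frame M] [Frame N]

/-! Everything is done in frames. A locale is strongly Hausdorff exactly when any two frame
homomorphisms `f`, `g` out of its frame satisfy `f x ≤ g x ⊔ disjointJoin f g` (`IsHausdorffFrame`):
the pair of coprojections into the coproduct is the universal case. In this form the condition
passes to sublocales and to subframes generated by Hausdorff images.

Existence: the colimit of a diagram in `HLoc` is carried by the subframe generated by all Hausdorff
images consisting of compatible families, provided a small family of objects is weakly terminal
(`hasColimit_of_weaklyTerminal`). Over `L` the compact sublocales form such a family, since every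
map from a compact locale factors through its image, which is compact.

Idempotency: `T L` is the colimit of all `K ⟶ L` with `K` compact, and its legs jointly reflect the
order (`le_of_leg_le`). By compactness and the Hausdorff property each point of `T L` factors
through a leg (`exists_point_factor`). Maps from a compact Hausdorff locale are determined by its
points (`hom_ext_of_points`), so every `f : K ⟶ T L` is the leg at `f ≫ ε` (`eq_leg`). Thus `ε` at
`T L` is a two-sided inverse of `δ` at `L`. -/

theorem map_inf_eq_bot (f : FrameHom L M) {a b : L} (h : a ⊓ b = ⊥) : f a ⊓ f b = ⊥ := by
  rw [← map_inf f, h, map_bot f]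

/-- The join of all `f a ⊓ g b` with `a` and `b` disjoint. -/
def disjointJoin (f g : FrameHom L N) : N :=
  ⨆ (a : L) (b : L) (_ : a ⊓ b = ⊥), f a ⊓ g b

theorem le_disjointJoin (f g : FrameHom L N) {a b : L} (h : a ⊓ b = ⊥) :
    f a ⊓ g b ≤ disjointJoin f g :=
  le_iSup_of_le a (le_iSup_of_le b (le_iSup_of_le h le_rfl))

theorem disjointJoin_le {f g : FrameHom L N} {c : N}
    (h : ∀ a b : L, a ⊓ b = ⊥ → f a ⊓ g b ≤ c) : disjointJoin f g ≤ c :=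
  iSup_le fun a => iSup_le fun b => iSup_le fun hab => h a b hab

theorem disjointJoin_comm (f g : FrameHom L N) : disjointJoin f g = disjointJoin g f := by
  refine le_antisymm ?_ ?_ <;> refine disjointJoin_le fun a b h => ?_ <;>
    rw [inf_comm] <;> exact le_disjointJoin _ _ (by rwa [inf_comm])

/-- A frame is Hausdorff if two frame homomorphisms out of it agree modulo the join of the values
which separate them. -/
def IsHausdorffFrame (L : Type u) [Frame L] : Prop :=
  ∀ (N : Type u) [Frame N] (f g : FrameHom L N) (x : L), f x ≤ g x ⊔ disjointJoin f g

/-- Disjoint pairs of `L` go to disjoint pairs of `M`, so precomposing with `q` can only shrink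
`disjointJoin`. This is how sublocales inherit the property. -/
theorem IsHausdorffFrame.of_surjective {L M : Type u} [Frame L] [Frame M]
    (hL : IsHausdorffFrame L) (q : FrameHom L M) (hq : Function.Surjective q) :
    IsHausdorffFrame M := by
  intro N _ f g x
  obtain ⟨x, rfl⟩ := hq x
  refine (hL N (f.comp q) (g.comp q) x).trans (sup_le_sup_left (disjointJoin_le fun a b h => ?_) _)
  exact le_disjointJoin f g (map_inf_eq_bot _ h)

/-! #### Subframes -/

/-- A set closed under finite meets and arbitrary joins. -/
structure IsSubframe (S : Set L) : Prop where
  top_mem : ⊤ ∈ S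
  inf_mem : ∀ a ∈ S, ∀ b ∈ S, a ⊓ b ∈ S
  sSup_mem : ∀ A ⊆ S, sSup A ∈ S

/-- The subframe generated by a set. -/
def subframeClosure (X : Set L) : Set L :=
  ⋂₀ {S | IsSubframe S ∧ X ⊆ S}

theorem subset_subframeClosure (X : Set L) : X ⊆ subframeClosure X :=
  Set.subset_sInter fun _ h => h.2

theorem subframeClosure_subset {X S : Set L} (hS : IsSubframe S) (h : X ⊆ S) :
    subframeClosure X ⊆ S :=
  Set.sInter_subset_of_mem ⟨hS, h⟩

theorem isSubframe_subframeClosure (X : Set L) : IsSubframe (subframeClosure X) where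
  top_mem := Set.mem_sInter.2 fun _ h => h.1.top_mem
  inf_mem a ha b hb := Set.mem_sInter.2 fun S h => h.1.inf_mem a (ha S h) b (hb S h)
  sSup_mem A hA := Set.mem_sInter.2 fun S h => h.1.sSup_mem A fun _ hx => hA hx S h

/-- Joins and binary meets are those of `L` on the nose, which makes the inclusion a frame
homomorphism by `rfl`. Infinite meets and implication need not be inherited from `L`, so they are
joins of the elements that qualify. -/
instance subframeClosure.instFrame (X : Set L) : Frame (subframeClosure X) :=
  have hS := isSubframe_subframeClosure X
  have hval : ∀ A : Set (subframeClosure X), Subtype.val '' A ⊆ subframeClosure X := by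
    rintro A _ ⟨x, _, rfl⟩; exact x.2
  have hsup : ∀ A : Set (subframeClosure X), IsLUB A ⟨sSup (Subtype.val '' A),
      hS.sSup_mem _ (hval A)⟩ := fun A => ⟨fun a ha => le_sSup (a := a.1) ⟨a, ha, rfl⟩,
        fun b hb => sSup_le (by rintro _ ⟨x, hx, rfl⟩; exact hb hx)⟩
  have hbot : ∀ x : subframeClosure X, sSup (Subtype.val '' (∅ : Set (subframeClosure X))) ≤ x.1 :=
    fun x => by simp
  have himp : ∀ a b c : subframeClosure X,
      a.1 ≤ sSup (Subtype.val '' {d : subframeClosure X | d.1 ⊓ b.1 ≤ c.1}) ↔ a.1 ⊓ b.1 ≤ c.1 :=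
    fun a b c => by
      refine ⟨fun h => (inf_le_inf_right _ h).trans ?_, fun h => le_sSup ⟨a, h, rfl⟩⟩
      rw [sSup_inf_eq]
      refine iSup₂_le ?_
      rintro _ ⟨d, hd, rfl⟩
      exact hd
  { __ := Subtype.partialOrder _
    sup := fun a b => ⟨sSup (Subtype.val '' {a, b}), hS.sSup_mem _ (hval _)⟩
    le_sup_left := fun a b => (hsup {a, b}).1 (Set.mem_insert _ _)
    le_sup_right := fun a b => (hsup {a, b}).1 (Set.mem_insert_of_mem _ rfl)
    sup_le := fun a b c h₁ h₂ => (hsup {a, b}).2 (by rintro _ (rfl | rfl) <;> assumption)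
    inf := fun a b => ⟨a.1 ⊓ b.1, hS.inf_mem _ a.2 _ b.2⟩
    inf_le_left := fun a b => inf_le_left (a := a.1)
    inf_le_right := fun a b => inf_le_right (a := a.1)
    le_inf := fun a b c h₁ h₂ => show a.1 ≤ b.1 ⊓ c.1 from le_inf h₁ h₂
    sSup := fun A => ⟨sSup (Subtype.val '' A), hS.sSup_mem _ (hval A)⟩
    isLUB_sSup := hsup
    sInf := fun A => ⟨sSup (Subtype.val '' lowerBounds A), hS.sSup_mem _ (hval _)⟩
    isGLB_sInf := fun A => ⟨fun a ha => (hsup (lowerBounds A)).2 fun b hb => hb ha,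
      fun b hb => (hsup (lowerBounds A)).1 hb⟩
    top := ⟨⊤, hS.top_mem⟩
    le_top := fun a => le_top (a := a.1)
    bot := ⟨sSup (Subtype.val '' (∅ : Set (subframeClosure X))), hS.sSup_mem _ (hval _)⟩
    bot_le := hbot
    himp := fun a b => ⟨sSup (Subtype.val '' {d : subframeClosure X | d.1 ⊓ a.1 ≤ b.1}),
      hS.sSup_mem _ (hval _)⟩
    le_himp_iff := himp
    compl := fun a => ⟨sSup (Subtype.val '' {d : subframeClosure X | d.1 ⊓ a.1 ≤
      sSup (Subtype.val '' (∅ : Set (subframeClosure X)))}), hS.sSup_mem _ (hval _)⟩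
    himp_bot := fun _ => rfl }

/-- The inclusion of a generated subframe. -/
def subframeClosure.incl (X : Set L) : FrameHom (subframeClosure X) L where
  toFun := Subtype.val
  map_inf' _ _ := rfl
  map_top' := rfl
  map_sSup' _ := rfl

/-- The restriction of the codomain of a frame homomorphism to a generated subframe. -/
def subframeClosure.codRestrict (X : Set L) (f : FrameHom M L) (h : ∀ x, f x ∈ subframeClosure X) :
    FrameHom M (subframeClosure X) where
  toFun x := ⟨f x, h x⟩
  map_inf' a b := Subtype.ext (map_inf f a b)
  map_top' := Subtype.ext (map_top f)
  map_sSup' A := Subtype.ext <| (map_sSup f A).trans <| by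
    change _ = sSup _
    rw [← Set.image_comp]
    rfl

/-- A subframe generated by the images of Hausdorff frames is Hausdorff. -/
theorem isHausdorffFrame_subframeClosure {L : Type u} [Frame L] (X : Set L)
    (hX : ∀ x ∈ X, ∃ (H : Type u) (_ : Frame H) (f : FrameHom H L), IsHausdorffFrame H ∧
      (∀ y, f y ∈ X) ∧ x ∈ Set.range f) : IsHausdorffFrame (subframeClosure X) := by
  intro N _ f g
  -- As `disjointJoin f g` does not depend on `x`, the elements satisfying the Hausdorff inequality
  -- form a subframe, so checking it on generators is enough.
  let S : Set L := {x | ∃ h : x ∈ subframeClosure X, f ⟨x, h⟩ ≤ g ⟨x, h⟩ ⊔ disjointJoin f g}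
  have hS : IsSubframe S := by
    refine ⟨⟨(isSubframe_subframeClosure X).top_mem, ?_⟩, ?_, ?_⟩
    · exact le_sup_of_le_left ((map_top f).le.trans (map_top g).ge)
    · rintro a ⟨ha, ha'⟩ b ⟨hb, hb'⟩
      refine ⟨(isSubframe_subframeClosure X).inf_mem a ha b hb, ?_⟩
      calc f ((⟨a, ha⟩ : subframeClosure X) ⊓ ⟨b, hb⟩) = f ⟨a, ha⟩ ⊓ f ⟨b, hb⟩ :=
            map_inf f _ _
        _ ≤ _ := inf_le_inf ha' hb'
        _ = (g ⟨a, ha⟩ ⊓ g ⟨b, hb⟩) ⊔ disjointJoin f g := sup_inf_right _ _ _ |>.symm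
        _ = _ := by rw [← map_inf]; rfl
    · intro A hA
      have hA' : A ⊆ subframeClosure X := fun a ha => (hA ha).1
      refine ⟨(isSubframe_subframeClosure X).sSup_mem A hA', ?_⟩
      let B : Set (subframeClosure X) := Subtype.val ⁻¹' A
      have hB : (⟨sSup A, (isSubframe_subframeClosure X).sSup_mem A hA'⟩ : subframeClosure X) =
          sSup B := Subtype.ext <| by
        change sSup A = sSup (Subtype.val '' B)
        rw [Subtype.image_preimage_coe, Set.inter_eq_right.2 hA']
      rw [hB, map_sSup]
      refine sSup_le ?_
      rintro _ ⟨b, hb, rfl⟩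
      exact (hA hb).2.trans (sup_le_sup_right (OrderHomClass.mono g (le_sSup hb)) _)
  have hXS : X ⊆ S := by
    intro x hx
    obtain ⟨H, _, k, hH, hk, y, rfl⟩ := hX x hx
    refine ⟨subset_subframeClosure X hx, ?_⟩
    let k' := subframeClosure.codRestrict X k fun y => subset_subframeClosure X (hk y)
    refine (hH N (f.comp k') (g.comp k') y).trans
      (sup_le_sup_left (disjointJoin_le fun a b h => ?_) _)
    exact le_disjointJoin f g (map_inf_eq_bot _ h)
  exact fun x => (subframeClosure_subset hS hXS x.2).2

/-! #### Joint images -/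

/-- The join of the images of a family of localic maps, given by frame homomorphisms. -/
def jointImage {ι : Type*} {K : ι → Type*} [∀ i, Frame (K i)] (f : ∀ i, FrameHom L (K i)) :
    Sublocale L where
  carrier := {x | ∀ y, (∀ i, f i y ≤ f i x) → y ≤ x}
  sInf_mem' s hs y hy := le_sInf fun x hx =>
    hs hx y fun i => (hy i).trans (OrderHomClass.mono (f i) (sInf_le hx))
  himp_mem' a x hx y hy := by
    refine le_himp_iff.2 (hx _ fun i => ?_)
    calc f i (y ⊓ a) ≤ f i ((a ⇨ x) ⊓ a) := by
          rw [map_inf, map_inf]; exact inf_le_inf_right _ (hy i)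
      _ ≤ f i x := OrderHomClass.mono (f i) himp_inf_le

section

variable {ι : Type*} {K : ι → Type*} [∀ i, Frame (K i)] (f : ∀ i, FrameHom L (K i))

/-- Since each `f i` preserves joins, there is a largest `z` with `f i z ≤ f i x` for all `i`. It
lies in the joint image and above `x`, hence above `restrict x`. -/
theorem map_restrict_jointImage (i : ι) (x : L) :
    f i ((jointImage f).restrict x : L) = f i x := by
  refine le_antisymm ?_ (OrderHomClass.mono (f i) ((jointImage f).giRestrict.gc.le_u_l x))
  let z := sSup {y | ∀ i, f i y ≤ f i x}
  have hz : ∀ i, f i z ≤ f i x := fun i => by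
    rw [map_sSup]
    refine sSup_le ?_
    rintro _ ⟨y, hy, rfl⟩
    exact hy i
  have hxz : x ≤ z := le_sSup fun i => le_rfl
  have hzS : z ∈ jointImage f := fun y hy => le_sSup fun i => (hy i).trans (hz i)
  have h : (jointImage f).restrict x ≤ ⟨z, hzS⟩ :=
    (jointImage f).giRestrict.gc.l_le (show x ≤ z from hxz)
  exact (OrderHomClass.mono (f i) (show ((jointImage f).restrict x : L) ≤ z from h)).trans (hz i)

theorem restrict_surjective (S : Sublocale L) : Function.Surjective S.restrict :=
  fun x => ⟨x, S.restrict_of_mem x.2⟩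

/-- The factorization of a member of a family through the joint image. -/
def jointImageFactor (i : ι) : FrameHom (jointImage f) (K i) where
  toFun x := f i x
  map_inf' a b := map_inf (f i) a.1 b.1
  map_top' := map_top (f i)
  map_sSup' A := by
    have h : (jointImage f).restrict (sSup (Subtype.val '' A)) = sSup A := by
      rw [map_sSup, ← Set.image_comp]
      congr 1
      refine (Set.image_congr fun x _ => ?_).trans (Set.image_id A)
      exact (jointImage f).restrict_of_mem x.2
    change f i (sSup A : jointImage f) = _
    rw [← h, map_restrict_jointImage, map_sSup, ← Set.image_comp]
    rfl

theorem jointImageFactor_restrict (i : ι) (x : L) :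
    jointImageFactor f i ((jointImage f).restrict x) = f i x :=
  map_restrict_jointImage f i x

theorem jointImage_le {x y : jointImage f}
    (h : ∀ i, jointImageFactor f i x ≤ jointImageFactor f i y) : x ≤ y :=
  y.2 x h

end

/-! #### The coproduct of two frames -/

/-- The coproduct of two frames, consisting of the lower sets in their product which are closed
under joins in each variable. -/
def frameCoprod (L M : Type*) [Frame L] [Frame M] : Sublocale (LowerSet (L × M)) where
  carrier := {U | (∀ (A : Set L) (b : M), (∀ a ∈ A, (a, b) ∈ U) → (sSup A, b) ∈ U) ∧
    ∀ (a : L) (B : Set M), (∀ b ∈ B, (a, b) ∈ U) → (a, sSup B) ∈ U}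
  sInf_mem' s hs := by
    refine ⟨fun A b h => ?_, fun a B h => ?_⟩ <;> rw [LowerSet.mem_sInf_iff] <;> intro U hU
    · exact (hs hU).1 A b fun a ha => LowerSet.mem_sInf_iff.1 (h a ha) U hU
    · exact (hs hU).2 a B fun b hb => LowerSet.mem_sInf_iff.1 (h b hb) U hU
  himp_mem' W U hU := by
    have key : ∀ x : L × M, x ∈ W ⇨ U ↔ ∀ y ≤ x, y ∈ W → y ∈ U := by
      intro x
      rw [← LowerSet.Iic_le, le_himp_iff]
      exact ⟨fun h y hy hW => h ⟨hy, hW⟩, fun h y hy => h y hy.1 hy.2⟩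
    refine ⟨fun A b h => ?_, fun a B h => ?_⟩ <;> rw [key] <;> rintro ⟨c, d⟩ ⟨h₁, h₂⟩ hW
    · have hc : c = sSup ((c ⊓ ·) '' A) := by
        rw [sSup_image, ← inf_sSup_eq]; exact (inf_eq_left.2 h₁).symm
      rw [hc]
      refine hU.1 _ _ ?_
      rintro _ ⟨a, ha, rfl⟩
      exact (key _).1 (h a ha) _ ⟨inf_le_right, h₂⟩
        (W.lower (Prod.mk_le_mk.2 ⟨inf_le_left, le_rfl⟩) hW)
    · have hd : d = sSup ((d ⊓ ·) '' B) := by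
        rw [sSup_image, ← inf_sSup_eq]; exact (inf_eq_left.2 h₂).symm
      rw [hd]
      refine hU.2 _ _ ?_
      rintro _ ⟨b, hb, rfl⟩
      exact (key _).1 (h b hb) _ ⟨h₁, inf_le_right⟩
        (W.lower (Prod.mk_le_mk.2 ⟨le_rfl, inf_le_left⟩) hW)

namespace frameCoprod

/-- The pure tensor `a ⊗ b`. -/
def tmul (a : L) (b : M) : frameCoprod L M :=
  (frameCoprod L M).restrict (LowerSet.Iic (a, b))

theorem tmul_le_iff {a : L} {b : M} {U : frameCoprod L M} : tmul a b ≤ U ↔ (a, b) ∈ U.1 :=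
  ((frameCoprod L M).giRestrict.gc _ _).trans LowerSet.Iic_le

theorem mem_tmul (a : L) (b : M) : (a, b) ∈ (tmul a b).1 :=
  tmul_le_iff.1 le_rfl

theorem tmul_inf_tmul (a c : L) (b d : M) :
    tmul a b ⊓ tmul c d = tmul (a ⊓ c) (b ⊓ d) := by
  rw [tmul, tmul, tmul, ← map_inf, ← LowerSet.Iic_inf, Prod.mk_inf_mk]

theorem tmul_sSup_left (A : Set L) (b : M) : tmul (sSup A) b = sSup ((tmul · b) '' A) := by
  refine le_antisymm ?_ (sSup_le ?_)
  · refine tmul_le_iff.2 ((sSup ((tmul · b) '' A)).2.1 A b fun a ha => ?_)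
    exact tmul_le_iff.1 (le_sSup ⟨a, ha, rfl⟩)
  · rintro _ ⟨a, ha, rfl⟩
    exact tmul_le_iff.2 (LowerSet.lower _ (Prod.mk_le_mk.2 ⟨le_sSup ha, le_rfl⟩) (mem_tmul _ _))

theorem tmul_sSup_right (a : L) (B : Set M) : tmul a (sSup B) = sSup ((tmul a ·) '' B) := by
  refine le_antisymm ?_ (sSup_le ?_)
  · refine tmul_le_iff.2 ((sSup ((tmul a ·) '' B)).2.2 a B fun b hb => ?_)
    exact tmul_le_iff.1 (le_sSup ⟨b, hb, rfl⟩)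
  · rintro _ ⟨b, hb, rfl⟩
    exact tmul_le_iff.2 (LowerSet.lower _ (Prod.mk_le_mk.2 ⟨le_rfl, le_sSup hb⟩) (mem_tmul _ _))

theorem tmul_top_top : tmul (⊤ : L) (⊤ : M) = ⊤ := by
  rw [tmul, show ((⊤ : L), (⊤ : M)) = ⊤ from rfl, LowerSet.Iic_top, map_top]

/-- The first coprojection. -/
def inl (L M : Type*) [Frame L] [Frame M] : FrameHom L (frameCoprod L M) where
  toFun a := tmul a ⊤
  map_inf' a b := by rw [tmul_inf_tmul, inf_idem]
  map_top' := tmul_top_top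
  map_sSup' A := tmul_sSup_left A ⊤

/-- The second coprojection. -/
def inr (L M : Type*) [Frame L] [Frame M] : FrameHom M (frameCoprod L M) where
  toFun b := tmul ⊤ b
  map_inf' a b := by rw [tmul_inf_tmul, inf_idem]
  map_top' := tmul_top_top
  map_sSup' B := tmul_sSup_right ⊤ B

theorem inl_inf_inr (a : L) (b : M) : inl L M a ⊓ inr L M b = tmul a b := by
  change tmul a ⊤ ⊓ tmul ⊤ b = _
  rw [tmul_inf_tmul, inf_top_eq, top_inf_eq]

theorem le_iff {U V : frameCoprod L M} :
    U ≤ V ↔ ∀ a b, (a, b) ∈ U.1 → inl L M a ⊓ inr L M b ≤ V := by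
  refine ⟨fun h a b hab => ?_, fun h => ?_⟩
  · rw [inl_inf_inr, tmul_le_iff]
    exact h hab
  · rintro ⟨a, b⟩ hab
    have := h a b hab
    rwa [inl_inf_inr, tmul_le_iff] at this

/-- By distributivity the pairs with `f a ⊓ g b ≤ n` form an element of the coproduct, so they
contain the closure of `V` once they contain `V`. This avoids any explicit description of the
closure. -/
theorem inf_le_of_mem_restrict (f : FrameHom L N) (g : FrameHom M N) {V : LowerSet (L × M)} {n : N}
    (h : ∀ a b, (a, b) ∈ V → f a ⊓ g b ≤ n) {a : L} {b : M}
    (hab : (a, b) ∈ ((frameCoprod L M).restrict V).1) : f a ⊓ g b ≤ n := by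
  let W : LowerSet (L × M) := ⟨{x | f x.1 ⊓ g x.2 ≤ n}, fun x y hxy hx =>
    (inf_le_inf (OrderHomClass.mono f hxy.1) (OrderHomClass.mono g hxy.2)).trans hx⟩
  have hW : W ∈ frameCoprod L M := by
    refine ⟨fun A b h => ?_, fun a B h => ?_⟩
    · change f (sSup A) ⊓ g b ≤ n
      rw [map_sSup, sSup_inf_eq]
      refine iSup₂_le ?_
      rintro _ ⟨a, ha, rfl⟩
      exact h a ha
    · change f a ⊓ g (sSup B) ≤ n
      rw [map_sSup, inf_sSup_eq]
      refine iSup₂_le ?_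
      rintro _ ⟨b, hb, rfl⟩
      exact h b hb
  have h' : (frameCoprod L M).restrict V ≤ ⟨W, hW⟩ :=
    (frameCoprod L M).giRestrict.gc.l_le (show V ≤ W from fun x hx => h x.1 x.2 hx)
  exact h' hab

/-- The copairing of two frame homomorphisms. -/
def desc (f : FrameHom L N) (g : FrameHom M N) : FrameHom (frameCoprod L M) N :=
  { toFun := fun U => ⨆ x ∈ U.1, f x.1 ⊓ g x.2
    map_inf' := fun U V => by
      refine le_antisymm (le_inf ?_ ?_) ?_
      · exact iSup₂_le fun x hx => le_iSup₂_of_le x hx.1 le_rfl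
      · exact iSup₂_le fun x hx => le_iSup₂_of_le x hx.2 le_rfl
      · simp_rw [iSup_inf_eq, inf_iSup_eq]
        refine iSup₂_le fun x hx => iSup₂_le fun y hy => le_iSup₂_of_le (x ⊓ y)
          ⟨U.1.lower inf_le_left hx, V.1.lower inf_le_right hy⟩ ?_
        rw [Prod.fst_inf, Prod.snd_inf, map_inf, map_inf]
        exact (inf_inf_inf_comm _ _ _ _).le
    map_top' := top_le_iff.1 <| le_iSup₂_of_le (⊤, ⊤) trivial (by simp)
    map_sSup' := fun A => by
      refine le_antisymm ?_ (sSup_le ?_)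
      · have h : (frameCoprod L M).restrict (sSup (Subtype.val '' A)) = sSup A := by
          rw [map_sSup, ← Set.image_comp]
          congr 1
          refine (Set.image_congr fun x _ => ?_).trans (Set.image_id A)
          exact (frameCoprod L M).restrict_of_mem x.2
        refine iSup₂_le fun x hx => ?_
        rw [← h] at hx
        refine inf_le_of_mem_restrict f g (fun a b hab => ?_) hx
        obtain ⟨_, ⟨U, hU, rfl⟩, hab⟩ := LowerSet.mem_sSup_iff.1 hab
        exact le_trans (le_iSup₂_of_le (a, b) hab le_rfl) (le_sSup ⟨U, hU, rfl⟩)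
      · rintro _ ⟨U, hU, rfl⟩
        exact iSup₂_le fun x hx => le_iSup₂_of_le x ((le_sSup hU : U ≤ sSup A) hx) le_rfl }

theorem desc_apply (f : FrameHom L N) (g : FrameHom M N) (U : frameCoprod L M) :
    desc f g U = ⨆ x ∈ U.1, f x.1 ⊓ g x.2 := rfl

theorem hom_ext {h k : FrameHom (frameCoprod L M) N} (h₁ : ∀ a, h (inl L M a) = k (inl L M a))
    (h₂ : ∀ b, h (inr L M b) = k (inr L M b)) : h = k := by
  ext U
  have hU : U = sSup {V | ∃ a b, (a, b) ∈ U.1 ∧ V = inl L M a ⊓ inr L M b} := by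
    refine le_antisymm (le_iff.2 fun a b hab => le_sSup ⟨a, b, hab, rfl⟩) (sSup_le ?_)
    rintro _ ⟨a, b, hab, rfl⟩
    rw [inl_inf_inr]
    exact tmul_le_iff.2 hab
  rw [hU, map_sSup, map_sSup]
  congr 1
  refine Set.image_congr ?_
  rintro _ ⟨a, b, hab, rfl⟩
  rw [map_inf, map_inf, h₁, h₂]

theorem desc_tmul (f : FrameHom L N) (g : FrameHom M N) (a : L) (b : M) :
    desc f g (tmul a b) = f a ⊓ g b := by
  refine le_antisymm (iSup₂_le fun x hx => ?_) (le_iSup₂_of_le (a, b) (mem_tmul a b) le_rfl)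
  refine inf_le_of_mem_restrict f g (fun c d hcd => ?_) hx
  have h : (c, d) ≤ (a, b) := hcd
  exact inf_le_inf (OrderHomClass.mono f h.1) (OrderHomClass.mono g h.2)

theorem desc_inl (f : FrameHom L N) (g : FrameHom M N) (a : L) :
    desc f g (inl L M a) = f a := by
  change desc f g (tmul a ⊤) = _
  rw [desc_tmul, map_top, inf_top_eq]

theorem desc_inr (f : FrameHom L N) (g : FrameHom M N) (b : M) :
    desc f g (inr L M b) = g b := by
  change desc f g (tmul ⊤ b) = _
  rw [desc_tmul, map_top, top_inf_eq]

end frameCoprod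

/-! #### Closed diagonals -/

/-- Two frame homomorphisms which are jointly generating and have a common retraction with a closed
localic map agree modulo the join of the values which separate them. -/
theorem le_sup_disjointJoin_of_isClosed (p₁ p₂ : FrameHom L M) (Δ : FrameHom M L) (r : L → M)
    (gc : GaloisConnection Δ r) (e₁ : ∀ x, Δ (p₁ x) = x) (e₂ : ∀ x, Δ (p₂ x) = x)
    (hgen : Function.Surjective (frameCoprod.desc p₁ p₂)) {b : M}
    (hb : r '' Set.Ici ⊥ = Set.Ici b) (x : L) : p₁ x ≤ p₂ x ⊔ disjointJoin p₁ p₂ := by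
  -- Closedness makes everything above `b` a value of `r`, so elements above `b` are determined by
  -- their image under `Δ`.
  have hr : ∀ u, b ≤ u → r (Δ u) = u := by
    intro u hu
    obtain ⟨y, -, rfl⟩ : u ∈ r '' Set.Ici ⊥ := by rw [hb]; exact hu
    exact gc.u_l_u_eq_u y
  have hΔb : Δ b = ⊥ := by
    refine le_bot_iff.1 ((gc _ _).2 ?_)
    have : r ⊥ ∈ Set.Ici b := by rw [← hb]; exact ⟨⊥, le_rfl, rfl⟩
    exact this
  have key : p₁ x ⊔ b = p₂ x ⊔ b := by
    rw [← hr (p₁ x ⊔ b) le_sup_right, ← hr (p₂ x ⊔ b) le_sup_right, map_sup, map_sup, e₁, e₂]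
  -- `b` is a join of rectangles `p₁ y.1 ⊓ p₂ y.2`; applying `Δ` to one gives `y.1 ⊓ y.2 ≤ Δ b = ⊥`.
  have hbd : b ≤ disjointJoin p₁ p₂ := by
    obtain ⟨U, rfl⟩ := hgen b
    refine iSup₂_le fun y hy => le_disjointJoin p₁ p₂ (le_bot_iff.1 ?_)
    rw [← hΔb, frameCoprod.desc_apply, map_iSup₂]
    refine le_iSup₂_of_le y hy ?_
    rw [map_inf, e₁, e₂]
  exact (le_sup_left.trans key.le).trans (sup_le_sup_left hbd _)

/-- The codiagonal of a frame. -/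
def frameCoprod.codiag (L : Type*) [Frame L] : FrameHom (frameCoprod L L) L :=
  frameCoprod.desc (FrameHom.id L) (FrameHom.id L)

/-- Any `U` above `r a` contains `d`, because the codiagonal kills disjoint rectangles. Modulo `d`
the two coprojections agree, so membership of `x ⊗ y` in `U` depends only on `x ⊓ y`, and `U` is
recovered as `r` of its codiagonal image. -/
theorem IsHausdorffFrame.image_Ici_codiag {L : Type u} [Frame L] (hL : IsHausdorffFrame L)
    (r : L → frameCoprod L L) (gc : GaloisConnection (frameCoprod.codiag L) r) (a : L) :
    r '' Set.Ici a = Set.Ici (r a) := by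
  have hD : ∀ x y, frameCoprod.codiag L (frameCoprod.tmul x y) = x ⊓ y :=
    frameCoprod.desc_tmul _ _
  set i₁ := frameCoprod.inl L L
  set i₂ := frameCoprod.inr L L
  set d := disjointJoin i₁ i₂
  refine Set.Subset.antisymm ?_ fun U (hU : r a ≤ U) => ?_
  · rintro _ ⟨x, hx, rfl⟩
    exact gc.monotone_u hx
  have hdU : d ≤ U := disjointJoin_le fun x y hxy => by
    rw [frameCoprod.inl_inf_inr]
    exact ((gc _ _).1 (by rw [hD, hxy]; exact bot_le)).trans hU
  have hle : ∀ x, i₁ x ⊓ d ≤ U := fun x => inf_le_right.trans hdU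
  have hi₁U : i₁ (frameCoprod.codiag L U) ≤ U := by
    rw [frameCoprod.codiag, frameCoprod.desc_apply, map_iSup₂]
    refine iSup₂_le fun z hz => ?_
    have hz' : i₁ z.1 ⊓ i₂ z.2 ≤ U := by
      rw [frameCoprod.inl_inf_inr]
      exact frameCoprod.tmul_le_iff.2 hz
    calc i₁ (z.1 ⊓ z.2) = i₁ z.1 ⊓ i₁ z.2 := map_inf i₁ _ _
      _ ≤ i₁ z.1 ⊓ (i₂ z.2 ⊔ d) := inf_le_inf_left _ (hL _ i₁ i₂ z.2)
      _ = (i₁ z.1 ⊓ i₂ z.2) ⊔ (i₁ z.1 ⊓ d) := inf_sup_left _ _ _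
      _ ≤ U := sup_le hz' (hle _)
  refine ⟨frameCoprod.codiag L U, ?_, le_antisymm (frameCoprod.le_iff.2 fun x y hxy => ?_)
    (gc.le_u_l U)⟩
  · have ha : frameCoprod.codiag L (i₁ a) = a := (hD a ⊤).trans (inf_top_eq a)
    refine le_of_eq_of_le ha.symm (OrderHomClass.mono (frameCoprod.codiag L) ?_)
    exact ((gc _ _).1 ha.le).trans hU
  · have hxy' : x ⊓ y ≤ frameCoprod.codiag L U := by
      rw [← hD x y]
      exact (gc _ _).2 (frameCoprod.tmul_le_iff.2 hxy)
    calc i₁ x ⊓ i₂ y ≤ i₁ x ⊓ (i₁ y ⊔ d) :=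
          inf_le_inf_left _ ((hL _ i₂ i₁ y).trans (by rw [disjointJoin_comm]))
      _ = i₁ (x ⊓ y) ⊔ (i₁ x ⊓ d) := by rw [inf_sup_left, map_inf]
      _ ≤ U := sup_le ((OrderHomClass.mono i₁ hxy').trans hi₁U) (hle _)

/-! #### Points and compactness -/

theorem disjointJoin_self (f : FrameHom L N) : disjointJoin f f = ⊥ :=
  le_bot_iff.1 (disjointJoin_le fun _ _ h => (map_inf_eq_bot f h).le)

theorem map_disjointJoin (h : FrameHom M N) (f g : FrameHom L M) :
    h (disjointJoin f g) = disjointJoin (h.comp f) (h.comp g) := by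
  simp only [disjointJoin, map_iSup, map_inf, FrameHom.comp_apply]

/-- If `f ≤ g` pointwise, disjoint `a`, `b` give `g a ⊓ f b ≤ g a ⊓ g b = ⊥`; nothing separates `g`
from `f`, so also `g ≤ f`. -/
theorem IsHausdorffFrame.eq_of_le {L N : Type u} [Frame L] [Frame N] (hL : IsHausdorffFrame L)
    {f g : FrameHom L N} (h : ∀ x, f x ≤ g x) : f = g := by
  ext x
  refine le_antisymm (h x) ((hL N g f x).trans (sup_le le_rfl ?_))
  refine (disjointJoin_le fun a b hab => ?_ : _ ≤ ⊥).trans bot_le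
  exact (inf_le_inf_left _ (h b)).trans (map_inf_eq_bot g hab).le

theorem isHausdorffFrame_set_punit : IsHausdorffFrame (Set PUnit.{u + 1}) := by
  intro N _ f g x
  rcases Set.eq_empty_or_nonempty x with rfl | ⟨⟨⟩, hx⟩
  · exact (map_bot f).le.trans bot_le
  · have h : x = ⊤ := Set.eq_univ_of_forall fun _ => hx
    rw [h, map_top g]
    exact le_sup_of_le_left le_top

/-- Compactness puts `a` below a coatom `m`. Coatoms are prime in a distributive lattice, so `x ↦ (¬
x ≤ m)` is a point. -/
theorem exists_point_of_ne_top (hL : ∀ A : Set L, sSup A = ⊤ → ∃ t ⊆ A, t.Finite ∧ sSup t = ⊤)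
    {a : L} (ha : a ≠ ⊤) : ∃ p : FrameHom L (Set PUnit.{u + 1}), p a = ⊥ := by
  have htop : IsCompactElement (⊤ : L) := by
    rw [CompleteLattice.isCompactElement_iff_exists_le_sSup_of_le_sSup]
    intro A hA
    obtain ⟨t, ht, hfin, hsup⟩ := hL A (top_le_iff.1 hA)
    refine ⟨hfin.toFinset, by simpa using ht, ?_⟩
    rw [Finset.sup_id_eq_sSup, hfin.coe_toFinset, hsup]
  obtain ⟨m, hm, ham⟩ :=
    ((CompleteLattice.coatomic_of_top_compact htop).eq_top_or_exists_le_coatom a).resolve_left ha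
  refine ⟨{ toFun := fun x => {_y | ¬ x ≤ m}, map_inf' := ?_, map_top' := ?_, map_sSup' := ?_ }, ?_⟩
  · intro x y
    ext z
    change ¬ x ⊓ y ≤ m ↔ ¬ x ≤ m ∧ ¬ y ≤ m
    rw [← not_or, not_iff_not]
    refine ⟨fun h => ?_, fun h => h.elim inf_le_of_left_le inf_le_of_right_le⟩
    by_contra hxy
    rw [not_or] at hxy
    have hx : m ⊔ x = ⊤ := hm.2 _ (left_lt_sup.2 hxy.1)
    have hy : m ⊔ y = ⊤ := hm.2 _ (left_lt_sup.2 hxy.2)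
    apply hm.1
    rw [← sup_eq_left.2 h, sup_inf_left, hx, hy, inf_top_eq]
  · exact Set.eq_univ_of_forall fun _ h => hm.1 (top_le_iff.1 h)
  · intro A
    ext z
    simp [sSup_le_iff]
  · exact Set.eq_empty_of_forall_notMem fun _ h => h ham

/-- This is regularity of compact Hausdorff frames: the proof shows that `e` lies below the join `ψ
⊥` of the elements rather below it. The set `W` is an element of the coproduct containing `e ⊗ ⊤`
and all disjoint rectangles, so the Hausdorff inequality puts `⊤ ⊗ e` into it. Compactness enters
only in the closure of `W` under joins in the first variable. -/
theorem IsHausdorffFrame.exists_compl_sup_eq_top {L : Type u} [Frame L] (hL : IsHausdorffFrame L)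
    (hc : ∀ A : Set L, sSup A = ⊤ → ∃ t ⊆ A, t.Finite ∧ sSup t = ⊤) {e : L} (he : e ≠ ⊥) :
    ∃ b ≠ ⊥, bᶜ ⊔ e = ⊤ := by
  let ψ : L → L := fun c => sSup {b | ∃ a, a ⊓ b = ⊥ ∧ a ⊔ (c ⊔ e) = ⊤}
  have hψ_of : ∀ {c : L}, c ⊔ e = ⊤ → ∀ b, b ≤ ψ c := fun {c} hce b =>
    le_top.trans (le_sSup ⟨⊥, bot_inf_eq _, by rw [hce, sup_top_eq]⟩)
  let W : LowerSet (L × L) := ⟨{x | ∀ c, x.1 ⊔ c = ⊤ → x.2 ≤ ψ c}, fun x y hxy hx c hc =>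
    hxy.2.trans (hx c (top_le_iff.1 (hc.ge.trans (sup_le_sup_right hxy.1 c))))⟩
  have hW : W ∈ frameCoprod L L := by
    refine ⟨fun A b h c hAc => ?_, fun a B h c hac => sSup_le fun b hb => h b hb c hac⟩
    -- The finite subcover is taken from `insert c A` and may contain `c`; the condition `c ≤ d`
    -- lets `c` be absorbed in the induction.
    have key : ∀ t : Set L, t.Finite → t ⊆ insert c A →
        ∀ d, c ≤ d → sSup t ⊔ d = ⊤ → b ≤ ψ d := by
      intro t ht
      induction t, ht using Set.Finite.induction_on with
      | empty =>
        intro _ d _ hd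
        rw [sSup_empty, bot_sup_eq] at hd
        exact hψ_of (by rw [hd, top_sup_eq]) b
      | @insert x t _ _ ih =>
        intro hsub d hcd hd
        rw [sSup_insert, sup_comm x, sup_assoc] at hd
        have ih' := ih ((Set.subset_insert x t).trans hsub) (x ⊔ d) (le_sup_of_le_right hcd) hd
        rcases hsub (Set.mem_insert x t) with rfl | hx
        · rwa [sup_eq_right.2 hcd] at ih'
        · rw [← inf_eq_left.2 ih', inf_sSup_eq]
          refine iSup₂_le ?_
          rintro b' ⟨a', hab', ha'⟩
          have hb : b ≤ ψ (a' ⊔ (d ⊔ e)) := h x hx _ <| by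
            rw [← ha', sup_left_comm x, sup_assoc]
          refine (inf_le_inf_right _ hb).trans ?_
          rw [sSup_inf_eq]
          refine iSup₂_le ?_
          rintro b'' ⟨a'', hab'', ha''⟩
          -- The witness `a'` of the induction hypothesis was put into the covering argument for
          -- `x`, so joining it with `a''` covers without `x` and stays disjoint from `b'' ⊓ b'`.
          refine le_sSup ⟨a'' ⊔ a', ?_, ?_⟩
          · rw [inf_sup_right, ← inf_assoc, hab'', bot_inf_eq, bot_sup_eq, inf_left_comm, hab',
              inf_bot_eq]
          · rw [← ha'', sup_assoc, sup_assoc, sup_assoc, sup_idem]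
    obtain ⟨t, htA, ht, htop⟩ := hc (insert c A) (by rw [sSup_insert, sup_comm]; exact hAc)
    exact key t ht htA c le_rfl (by rw [htop, top_sup_eq])
  have hle : frameCoprod.inl L L e ⊔
      disjointJoin (frameCoprod.inl L L) (frameCoprod.inr L L) ≤ ⟨W, hW⟩ := by
    refine sup_le (frameCoprod.tmul_le_iff.2 fun c h => hψ_of (by rwa [sup_comm]) _)
      (disjointJoin_le fun a b hab => ?_)
    rw [frameCoprod.inl_inf_inr]
    refine frameCoprod.tmul_le_iff.2 fun c h => le_sSup ⟨a, hab, ?_⟩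
    change a ⊔ c = ⊤ at h
    rw [← sup_assoc, h, top_sup_eq]
  have hmem : frameCoprod.tmul ⊤ e ≤ (⟨W, hW⟩ : frameCoprod L L) :=
    (hL _ (frameCoprod.inr L L) (frameCoprod.inl L L) e).trans (by rwa [disjointJoin_comm])
  -- The first coordinate of `⊤ ⊗ e` is already `⊤`, so `c = ⊥` is allowed.
  have heψ : e ≤ ψ ⊥ := frameCoprod.tmul_le_iff.1 hmem ⊥ (top_sup_eq _)
  by_contra! hcon
  refine he (le_bot_iff.1 (heψ.trans (sSup_le ?_)))
  rintro b ⟨a, hab, ha⟩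
  rw [bot_sup_eq] at ha
  by_contra hb
  refine hcon b (fun h => hb h.le) (top_le_iff.1 (ha.ge.trans (sup_le_sup_right ?_ e)))
  exact le_compl_iff_disjoint_right.2 (disjoint_iff.2 hab)

/-- Frame homomorphisms from a Hausdorff frame to a compact Hausdorff frame are determined by their
composites with points. -/
theorem IsHausdorffFrame.hom_ext_of_points {L K : Type u} [Frame L] [Frame K]
    (hL : IsHausdorffFrame L) (hK : IsHausdorffFrame K)
    (hc : ∀ A : Set K, sSup A = ⊤ → ∃ t ⊆ A, t.Finite ∧ sSup t = ⊤) {f g : FrameHom L K}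
    (h : ∀ r : FrameHom K (Set PUnit.{u + 1}), r.comp f = r.comp g) : f = g := by
  have hd : disjointJoin f g = ⊥ := by
    by_contra hne
    obtain ⟨b, hb, htop⟩ := hK.exists_compl_sup_eq_top hc hne
    -- A point killing `bᶜ` must send `disjointJoin f g` to `⊤`, but it identifies `f` and `g` and
    -- so sends it to `⊥`.
    obtain ⟨r, hr⟩ := exists_point_of_ne_top.{u} hc (a := bᶜ) fun h => hb <|
      disjoint_top.1 (le_compl_iff_disjoint_left.1 h.ge)
    have h₁ := congrArg r htop
    rw [map_sup, hr, map_disjointJoin, h r, disjointJoin_self, map_top, bot_sup_eq] at h₁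
    exact bot_ne_top h₁
  exact hL.eq_of_le fun x => (hL K f g x).trans (by rw [hd, sup_bot_eq])

/-- Every point of a Hausdorff frame with an order-reflecting family of frame homomorphisms to
compact frames factors through a member of the family. -/
theorem IsHausdorffFrame.exists_point_factor {L : Type u} [Frame L] (hL : IsHausdorffFrame L)
    {ι : Type*} {K : ι → Type u} [∀ i, Frame (K i)] (f : ∀ i, FrameHom L (K i))
    (hf : ∀ x y, (∀ i, f i x ≤ f i y) → x ≤ y)
    (hc : ∀ i, ∀ A : Set (K i), sSup A = ⊤ → ∃ t ⊆ A, t.Finite ∧ sSup t = ⊤)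
    (p : FrameHom L (Set PUnit.{u + 1})) :
    ∃ (i : ι) (r : FrameHom (K i) (Set PUnit.{u + 1})), r.comp (f i) = p := by
  -- `w` is the largest element killed by `p`. A point `r` killing `f i w` gives `r.comp (f i) ≤ p`,
  -- which is an equality by the Hausdorff property.
  let w := sSup {a | p a = ⊥}
  have hw : p w = ⊥ := by
    rw [map_sSup, sSup_eq_bot]
    rintro _ ⟨a, ha, rfl⟩
    exact ha
  obtain ⟨i, hi⟩ : ∃ i, f i w ≠ ⊤ := by
    by_contra! hcon
    have h := top_le_iff.1 (hf ⊤ w fun i => by rw [hcon i]; exact le_top)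
    rw [h, map_top] at hw
    exact top_ne_bot hw
  obtain ⟨r, hr⟩ := exists_point_of_ne_top.{u} (hc i) hi
  refine ⟨i, r, hL.eq_of_le fun a => ?_⟩
  rcases Set.eq_empty_or_nonempty (p a) with h | ⟨⟨⟩, h⟩
  · refine le_of_le_of_eq (OrderHomClass.mono r (OrderHomClass.mono (f i) ?_)) hr |>.trans bot_le
    exact le_sSup h
  · exact fun _ _ => h

end Frames
/-! ### Locales -/

namespace Locale

/-! ### Binary products of locales, and strong Hausdorffness as a condition on frames. -/

variable {L M N : Locale.{u}}

/-- The morphism of locales given by a frame homomorphism. -/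
def ofFrameHom (f : FrameHom M L) : L ⟶ M :=
  Quiver.Hom.op (V := Frm) (ConcreteCategory.ofHom (C := Frm) f)

theorem hom_ext {f g : L ⟶ M} (h : ∀ x, pullback f x = pullback g x) : f = g :=
  Quiver.Hom.unop_inj (Frm.ext h)

/-- The product of two locales. -/
def prodFan (L M : Locale.{u}) : BinaryFan L M :=
  BinaryFan.mk (P := Locale.of (frameCoprod L M)) (ofFrameHom (frameCoprod.inl L M))
    (ofFrameHom (frameCoprod.inr L M))

/-- The universal property of the product of two locales. -/
def prodFanIsLimit (L M : Locale.{u}) : IsLimit (prodFan L M) :=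
  BinaryFan.IsLimit.mk _
    (fun f g => ofFrameHom (M := Locale.of (frameCoprod L M))
      (frameCoprod.desc (pullback f) (pullback g)))
    (fun f g => hom_ext fun x => frameCoprod.desc_inl (pullback f) (pullback g) x)
    (fun f g => hom_ext fun x => frameCoprod.desc_inr (pullback f) (pullback g) x)
    (fun f g m h₁ h₂ => hom_ext fun x => DFunLike.congr_fun (frameCoprod.hom_ext
      (h := pullback m) (k := frameCoprod.desc (pullback f) (pullback g))
      (fun a => (DFunLike.congr_fun (congrArg pullback h₁) a).trans
        (frameCoprod.desc_inl (pullback f) (pullback g) a).symm)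
      (fun a => (DFunLike.congr_fun (congrArg pullback h₂) a).trans
        (frameCoprod.desc_inr (pullback f) (pullback g) a).symm)) x)

/-- Closedness applied to the whole locale (`a = ⊥`) yields the inequality for the two projections;
any other pair is obtained from these by a map into the product. -/
theorem isHausdorffFrame_of_isStronglyHausdorff (h : IsStronglyHausdorff L) :
    IsHausdorffFrame L := by
  obtain ⟨c, hc, hΔ⟩ := h
  obtain ⟨hΔ₁, hΔ₂⟩ := (BinaryFan.IsLimit.lift' hc (𝟙 L) (𝟙 L)).2
  set Δ := (BinaryFan.IsLimit.lift' hc (𝟙 L) (𝟙 L)).1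
  have e₁ : ∀ x, pullback Δ (pullback c.fst x) = x := fun x =>
    DFunLike.congr_fun (congrArg pullback hΔ₁) x
  have e₂ : ∀ x, pullback Δ (pullback c.snd x) = x := fun x =>
    DFunLike.congr_fun (congrArg pullback hΔ₂) x
  obtain ⟨b, hb⟩ := hΔ ⊥
  intro N _ f g x
  let N' : Locale.{u} := Locale.of N
  obtain ⟨h, h₁, h₂⟩ := BinaryFan.IsLimit.lift' hc (ofFrameHom (L := N') f)
    (ofFrameHom (L := N') g)
  have hf : (pullback h).comp (pullback c.fst) = f := congrArg pullback h₁
  have hg : (pullback h).comp (pullback c.snd) = g := congrArg pullback h₂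
  let T : Locale.{u} := Locale.of (frameCoprod L L)
  let θ : c.pt ⟶ T := ofFrameHom (frameCoprod.desc (pullback c.fst) (pullback c.snd))
  obtain ⟨k, hk₁, hk₂⟩ := BinaryFan.IsLimit.lift' hc
    (ofFrameHom (L := T) (frameCoprod.inl L L)) (ofFrameHom (L := T) (frameCoprod.inr L L))
  -- Comparison with the concrete product shows that the frame of an arbitrary product is generated
  -- by rectangles.
  have hθ : θ ≫ k = 𝟙 c.pt := by
    refine BinaryFan.IsLimit.hom_ext hc (.trans ?_ (Category.id_comp c.fst).symm)
      (.trans ?_ (Category.id_comp c.snd).symm)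
    · exact (Category.assoc _ _ _).trans ((congrArg (θ ≫ ·) hk₁).trans
        (hom_ext fun a => frameCoprod.desc_inl (pullback c.fst) (pullback c.snd) a))
    · exact (Category.assoc _ _ _).trans ((congrArg (θ ≫ ·) hk₂).trans
        (hom_ext fun a => frameCoprod.desc_inr (pullback c.fst) (pullback c.snd) a))
  have key := le_sup_disjointJoin_of_isClosed (pullback c.fst) (pullback c.snd) (pullback Δ)
    (localicMap Δ) (gc_pullback_localicMap Δ) e₁ e₂
    (fun u => ⟨pullback k u, DFunLike.congr_fun (congrArg pullback hθ) u⟩) hb x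
  have key' := OrderHomClass.mono (pullback h) key
  rw [map_sup, map_disjointJoin] at key'
  subst hf hg
  exact key'

theorem isStronglyHausdorff_of_isHausdorffFrame (hL : IsHausdorffFrame L) :
    IsStronglyHausdorff L :=
  ⟨prodFan L L, prodFanIsLimit L L, fun a => ⟨_, hL.image_Ici_codiag _
    (gc_pullback_localicMap (ofFrameHom (M := Locale.of (frameCoprod L L))
      (frameCoprod.codiag L))) a⟩⟩

end Locale
/-! ### Colimits of Hausdorff locales -/

section Pi

open Order

variable {ι : Type*} {K : ι → Type*} [∀ i, Frame (K i)]

/-- The evaluation homomorphism of a product of frames. -/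
def piEval (K : ι → Type*) [∀ i, Frame (K i)] (i : ι) : FrameHom (∀ i, K i) (K i) where
  toFun x := x i
  map_inf' _ _ := rfl
  map_top' := rfl
  map_sSup' A := by rw [sSup_apply, sSup_image, iSup_subtype]

/-- The homomorphism into a product of frames given by its components. -/
def piLift {L : Type*} [Frame L] (f : ∀ i, FrameHom L (K i)) : FrameHom L (∀ i, K i) where
  toFun x i := f i x
  map_inf' a b := funext fun i => map_inf (f i) a b
  map_top' := funext fun i => map_top (f i)
  map_sSup' A := funext fun i => by
    rw [map_sSup, sSup_image, sSup_image]
    simp only [iSup_apply]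

theorem isSubframe_equalizer {L M : Type*} [Frame L] [Frame M] (f g : FrameHom L M) :
    IsSubframe {x | f x = g x} where
  top_mem := (map_top f).trans (map_top g).symm
  inf_mem a ha b hb := by
    change f (a ⊓ b) = g (a ⊓ b)
    rw [map_inf, map_inf, show f a = g a from ha, show f b = g b from hb]
  sSup_mem A hA := by
    change f (sSup A) = g (sSup A)
    rw [map_sSup, map_sSup, Set.image_congr fun a ha => hA ha]

theorem subframeClosure_subset_equalizer {L M : Type*} [Frame L] [Frame M] {X : Set L}
    (f g : FrameHom L M) (h : ∀ x ∈ X, f x = g x) {x : L} (hx : x ∈ subframeClosure X) :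
    f x = g x :=
  subframeClosure_subset (isSubframe_equalizer f g) h hx

end Pi

namespace HLoc

open Locale

/-- The frame homomorphism of a morphism of Hausdorff locales. -/
def pb {L M : HLoc.{u}} (f : L ⟶ M) : FrameHom M.obj L.obj := pullback f.hom

theorem hom_ext {L M : HLoc.{u}} {f g : L ⟶ M} (h : pb f = pb g) : f = g :=
  ObjectProperty.hom_ext _ (Locale.hom_ext fun x => DFunLike.congr_fun h x)

/-- The morphism of Hausdorff locales given by a frame homomorphism. -/
def ofPb {L M : HLoc.{u}} (f : FrameHom M.obj L.obj) : L ⟶ M :=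
  ObjectProperty.homMk (ofFrameHom f)

/-- The Hausdorff locale given by a Hausdorff frame. -/
def of (L : Type u) [Order.Frame L] (hL : IsHausdorffFrame L) : HLoc.{u} :=
  ⟨Locale.of L, isStronglyHausdorff_of_isHausdorffFrame hL⟩

theorem isHausdorffFrame (L : HLoc.{u}) : IsHausdorffFrame L.obj :=
  isHausdorffFrame_of_isStronglyHausdorff L.property

/-! ### Colimits of possibly large diagrams with a small weakly terminal family. -/

variable {J : Type*} [Category* J] (F : J ⥤ HLoc.{u}) {I : Type u} (o : I → J)

/-- The elements of the product of the frames `F (o i)` lying in a Hausdorff frame of compatible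
families. -/
def compatibleSet : Set (∀ i, (F.obj (o i)).obj) :=
  {x | ∃ (H : Type u) (_ : Order.Frame H) (k : FrameHom H (∀ i, (F.obj (o i)).obj)),
    IsHausdorffFrame H ∧ (∀ (j : J) (i i' : I) (a : j ⟶ o i) (b : j ⟶ o i') (y : H),
      pb (F.map a) (k y i) = pb (F.map b) (k y i')) ∧ x ∈ Set.range k}

theorem isHausdorffFrame_compatible : IsHausdorffFrame (subframeClosure (compatibleSet F o)) := by
  refine isHausdorffFrame_subframeClosure _ ?_
  rintro x ⟨H, _, k, hH, hk, hx⟩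
  exact ⟨H, _, k, hH, fun y => ⟨H, _, k, hH, hk, y, rfl⟩, hx⟩

theorem compatible_of_mem {x : ∀ i, (F.obj (o i)).obj}
    (hx : x ∈ subframeClosure (compatibleSet F o)) {j : J} {i i' : I} (a : j ⟶ o i)
    (b : j ⟶ o i') : pb (F.map a) (x i) = pb (F.map b) (x i') := by
  refine subframeClosure_subset_equalizer
    ((pb (F.map a)).comp (piEval (fun i => (F.obj (o i)).obj) i))
    ((pb (F.map b)).comp (piEval (fun i => (F.obj (o i)).obj) i')) ?_ hx
  rintro _ ⟨H, _, k, hH, hk, y, rfl⟩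
  exact hk j i i' a b y

/-- The category of Hausdorff locales has colimits of all diagrams with a small weakly terminal
family of objects. -/
theorem hasColimit_of_weaklyTerminal (h : ∀ j, ∃ i, Nonempty (j ⟶ o i)) : HasColimit F := by
  choose i hi using h
  let m : ∀ j, j ⟶ o (i j) := fun j => (hi j).some
  let C : HLoc.{u} := of (subframeClosure (compatibleSet F o)) (isHausdorffFrame_compatible F o)
  let ev : ∀ k : I, FrameHom C.obj (F.obj (o k)).obj := fun k =>
    (piEval (fun k => (F.obj (o k)).obj) k).comp (subframeClosure.incl (compatibleSet F o))
  let leg : ∀ j, F.obj j ⟶ C := fun j => F.map (m j) ≫ ofPb (ev (i j))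
  -- Compatibility makes the leg independent of the chosen arrow `m j`, which gives naturality.
  have hleg : ∀ (j : J) (k : I) (a : j ⟶ o k), leg j = F.map a ≫ ofPb (ev k) := fun j k a =>
    hom_ext (by ext x; exact compatible_of_mem F o x.2 (m j) a)
  let c : Cocone F :=
    { pt := C
      ι :=
        { app := leg
          naturality := fun j j' a => by
            refine (Eq.trans ?_ (hleg j _ (a ≫ m j')).symm).trans (Category.comp_id _).symm
            rw [F.map_comp, Category.assoc] } }
  -- The frame of `s.pt` is itself Hausdorff and maps to compatible families, so its image is among
  -- the generators of `C`.
  let desc : ∀ s : Cocone F, C ⟶ s.pt := fun s =>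
    ofPb (L := C) (subframeClosure.codRestrict (compatibleSet F o)
      (piLift fun k => pb (s.ι.app (o k))) fun x => subset_subframeClosure _
        ⟨s.pt.obj, inferInstance, piLift fun k => pb (s.ι.app (o k)), isHausdorffFrame _,
          fun j i i' a b y => DFunLike.congr_fun
            (congrArg pb ((s.w a).trans (s.w b).symm)) y, x, rfl⟩)
  have hdesc : ∀ (s : Cocone F) (k : I), ofPb (ev k) ≫ desc s = s.ι.app (o k) := fun s k =>
    hom_ext rfl
  have hc : IsColimit c :=
    { desc := desc
      fac := fun s j => by
        change leg j ≫ desc s = _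
        rw [Category.assoc, hdesc, s.w]
      uniq := fun s g hg => by
        refine hom_ext ?_
        ext x
        refine Subtype.ext (funext fun k => ?_)
        have h₁ : ofPb (ev k) ≫ g = s.ι.app (o k) := by
          rw [← hg (o k)]
          change _ = leg (o k) ≫ g
          rw [hleg (o k) k (𝟙 _), F.map_id, Category.id_comp]
        exact DFunLike.congr_fun (congrArg pb h₁) x }
  exact ⟨⟨c, hc⟩⟩

/-! ### Compact sublocales -/

/-- The compact sublocales of a Hausdorff locale. -/
def CompactSublocale (L : HLoc.{u}) : Type u :=
  {S : Sublocale L.obj // Locale.IsCompact (Locale.of S)}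

/-- The Hausdorff locale given by a sublocale. -/
def ofSublocale {L : HLoc.{u}} (S : Sublocale L.obj) : HLoc.{u} :=
  of S (L.isHausdorffFrame.of_surjective S.restrict (restrict_surjective S))

/-- The inclusion of a sublocale. -/
def sublocaleIncl {L : HLoc.{u}} (S : Sublocale L.obj) : ofSublocale S ⟶ L :=
  ofPb (L := ofSublocale S) S.restrict

theorem isCompact_of_injective {K L : Locale.{u}} (hK : Locale.IsCompact K) (f : FrameHom L K)
    (hf : Function.Injective f) : Locale.IsCompact L := by
  intro A hA
  obtain ⟨t, htA, hfin, ht⟩ := hK (f '' A) (by rw [← map_sSup, hA, map_top])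
  refine ⟨A ∩ f ⁻¹' t, Set.inter_subset_left, (hfin.preimage hf.injOn).inter_of_right A, hf ?_⟩
  rw [map_sSup, map_top, Set.image_inter_preimage, Set.inter_eq_right.2 htA, ht]

/-- The compact sublocales as objects over a Hausdorff locale. -/
def compactArrow (L : HLoc.{u}) (S : CompactSublocale L) :
    CostructuredArrow inclusionKHLoc.{u} L :=
  CostructuredArrow.mk (S := inclusionKHLoc.{u}) (Y := (⟨ofSublocale S.1, S.2⟩ : KHLoc.{u}))
    (sublocaleIncl S.1)

/-- The arrow factors through its image, whose frame embeds in that of a compact locale and is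
therefore compact. Compact sublocales of `L` form a type in `Type u`, although the category of
arrows is large. -/
theorem exists_hom_compactArrow (L : HLoc.{u}) (X : CostructuredArrow inclusionKHLoc.{u} L) :
    ∃ S, Nonempty (X ⟶ compactArrow L S) := by
  let f : ∀ _ : Unit, FrameHom L.obj X.left.obj.obj := fun _ => pb X.hom
  have hinj : Function.Injective (jointImageFactor f ()) := fun x y h =>
    le_antisymm (jointImage_le f fun _ => h.le) (jointImage_le f fun _ => h.ge)
  let S : CompactSublocale L := ⟨jointImage f, isCompact_of_injective
    (L := Locale.of (jointImage f)) X.left.property _ hinj⟩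
  let g : X.left ⟶ (compactArrow L S).left :=
    ObjectProperty.homMk (ofPb (M := ofSublocale S.1) (jointImageFactor f ()))
  refine ⟨S, ⟨CostructuredArrow.homMk g (hom_ext (FrameHom.ext fun x => ?_))⟩⟩
  exact jointImageFactor_restrict f () x

theorem hasPointwiseLeftKanExtension :
    inclusionKHLoc.{u}.HasPointwiseLeftKanExtension inclusionKHLoc.{u} := fun L =>
  hasColimit_of_weaklyTerminal _ (compactArrow L) (exists_hom_compactArrow L)

end HLoc
/-! ### Idempotency of the density comonad -/

namespace HLoc

open Locale

/-- The one-point locale. -/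
def point : KHLoc.{u} where
  obj := of (Set PUnit.{u + 1}) isHausdorffFrame_set_punit
  property := by
    intro A (hA : ⋃₀ (A : Set (Set PUnit.{u + 1})) = Set.univ)
    obtain ⟨s, hs, h⟩ := Set.eq_univ_iff_forall.1 hA PUnit.unit
    refine ⟨{s}, Set.singleton_subset_iff.2 hs, Set.finite_singleton s, ?_⟩
    exact sSup_singleton.trans (Set.eq_univ_of_forall fun _ => h)

variable (E : inclusionKHLoc.{u}.LeftExtension inclusionKHLoc.{u})

/-- The legs of the cocones attached to a left extension. -/
def leg {L : HLoc.{u}} {K : KHLoc.{u}} (f : K.obj ⟶ L) : K.obj ⟶ E.right.obj L :=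
  E.hom.app K ≫ E.right.map f

theorem comp_leg {L : HLoc.{u}} {K K' : KHLoc.{u}} (h : K' ⟶ K) (f : K.obj ⟶ L) :
    h.hom ≫ leg E f = leg E (h.hom ≫ f) := by
  have := E.hom.naturality_assoc h (E.right.map f)
  rw [leg, leg, E.right.map_comp]
  exact this

variable {E}

theorem hom_ext_leg (hE : E.IsPointwiseLeftKanExtension) {L M : HLoc.{u}} {f g : E.right.obj L ⟶ M}
    (h : ∀ (K : KHLoc.{u}) (k : K.obj ⟶ L), leg E k ≫ f = leg E k ≫ g) : f = g :=
  (hE L).hom_ext fun X => h X.left X.hom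

theorem leg_counit (hE : E.IsPointwiseLeftKanExtension)
    {L : HLoc.{u}} {K : KHLoc.{u}} (f : K.obj ⟶ L) :
    leg E f ≫ (DensityComonad.counit E hE).app L = f := by
  rw [leg, Category.assoc]
  erw [(DensityComonad.counit E hE).naturality f]
  exact DensityComonad.unit_counit_comp E hE K f

theorem leg_comul (hE : E.IsPointwiseLeftKanExtension)
    {L : HLoc.{u}} {K : KHLoc.{u}} (f : K.obj ⟶ L) :
    leg E f ≫ (DensityComonad.comul E hE).app L = leg E (leg E f) := by
  have h := DensityComonad.unit_comul_comp E hE K (E.right.map (E.right.map f))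
  rw [leg, Category.assoc]
  erw [(DensityComonad.comul E hE).naturality f]
  exact h.trans (congrArg (E.hom.app K ≫ ·) (E.right.map_comp _ _).symm)

/-- The legs of the pointwise Kan extension jointly reflect the order. -/
theorem le_of_leg_le (hE : E.IsPointwiseLeftKanExtension) {L : HLoc.{u}} {x y : (E.right.obj L).obj}
    (h : ∀ (K : KHLoc.{u}) (k : K.obj ⟶ L), pb (leg E k) x ≤ pb (leg E k) y) : x ≤ y := by
  let ι := CostructuredArrow inclusionKHLoc.{u} L
  let f : ∀ X : ι, FrameHom (E.right.obj L).obj X.left.obj.obj := fun X => pb (leg E X.hom)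
  let S : HLoc.{u} := ofSublocale (jointImage f)
  let incl : S ⟶ E.right.obj L := sublocaleIncl (jointImage f)
  let factor : ∀ X : ι, X.left.obj ⟶ S := fun X => ofPb (M := S) (jointImageFactor f X)
  have hfactor : ∀ X, factor X ≫ incl = leg E X.hom := fun X =>
    HLoc.hom_ext (FrameHom.ext fun a => jointImageFactor_restrict f X a)
  let c : Cocone (CostructuredArrow.proj inclusionKHLoc.{u} L ⋙ inclusionKHLoc.{u}) :=
    { pt := S
      ι :=
        { app := factor
          naturality := fun X Y a => by
            refine Eq.trans ?_ (Category.comp_id _).symm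
            refine HLoc.hom_ext (FrameHom.ext fun s => ?_)
            have h₁ : a.left.hom ≫ leg E Y.hom = leg E X.hom := by
              rw [comp_leg]
              exact congrArg (leg E) (CostructuredArrow.w a)
            exact DFunLike.congr_fun (congrArg pb h₁) s.1 } }
  -- All legs factor through the joint image, so its inclusion is split by the colimit property and
  -- `restrict` is injective.
  have hretr : (hE L).desc c ≫ incl = 𝟙 _ := by
    refine (hE L).hom_ext fun X => ?_
    rw [(hE L).fac_assoc]
    exact (hfactor X).trans (Category.comp_id _).symm
  have hq : (jointImage f).restrict x ≤ (jointImage f).restrict y :=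
    jointImage_le f fun X => by
      rw [jointImageFactor_restrict, jointImageFactor_restrict]
      exact h X.left X.hom
  have hid : ∀ z, pb ((hE L).desc c) ((jointImage f).restrict z) = z := fun z =>
    DFunLike.congr_fun (congrArg pb hretr) z
  have := OrderHomClass.mono (pb ((hE L).desc c)) hq
  rwa [hid, hid] at this

/-- Writing `p` as a point `ρ` of some `K` followed by the leg at `k : K ⟶ L`, the counit turns it
into `ρ` followed by `k`, whose leg is `p` again. -/
theorem point_eq_leg (hE : E.IsPointwiseLeftKanExtension)
    {L : HLoc.{u}} (p : point.{u}.obj ⟶ E.right.obj L) :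
    p = leg E (p ≫ (DensityComonad.counit E hE).app L) := by
  obtain ⟨X, r, hr⟩ := (E.right.obj L).isHausdorffFrame.exists_point_factor
    (ι := CostructuredArrow inclusionKHLoc.{u} L) (K := fun X => X.left.obj.obj)
    (fun X => pb (leg E X.hom)) (fun x y h => le_of_leg_le hE fun K k =>
      h (CostructuredArrow.mk (S := inclusionKHLoc.{u}) (Y := K) k))
    (fun X => X.left.property) (pb p)
  let ρ : point.{u} ⟶ X.left := ObjectProperty.homMk (ofPb (L := point.{u}.obj) r)
  have hp : ρ.hom ≫ leg E X.hom = p := HLoc.hom_ext hr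
  have h₁ : p ≫ (DensityComonad.counit E hE).app L = ρ.hom ≫ X.hom := by
    rw [← hp, Category.assoc]
    exact congrArg (ρ.hom ≫ ·) (leg_counit hE X.hom)
  rw [h₁, ← comp_leg]
  exact hp.symm

/-- Composition with the counit is thus a bijection from maps `K ⟶ T L` to maps `K ⟶ L` for compact
`K`. The equation is tested on the points of `K`. -/
theorem eq_leg (hE : E.IsPointwiseLeftKanExtension)
    {L : HLoc.{u}} {K : KHLoc.{u}} (f : K.obj ⟶ E.right.obj L) :
    f = leg E (f ≫ (DensityComonad.counit E hE).app L) := by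
  refine HLoc.hom_ext ((E.right.obj L).isHausdorffFrame.hom_ext_of_points
    K.obj.isHausdorffFrame K.property fun r => ?_)
  let ρ : point.{u} ⟶ K := ObjectProperty.homMk (ofPb (L := point.{u}.obj) r)
  have h : ρ.hom ≫ f = ρ.hom ≫ leg E (f ≫ (DensityComonad.counit E hE).app L) := by
    rw [comp_leg, point_eq_leg hE (ρ.hom ≫ f), Category.assoc]
  exact congrArg pb h

theorem isIso_comul_app (hE : E.IsPointwiseLeftKanExtension)
    (L : HLoc.{u}) :
    IsIso ((DensityComonad.comul E hE).app L) := by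
  refine ⟨(DensityComonad.counit E hE).app (E.right.obj L),
    (densityComonad _ E hE).left_counit L, ?_⟩
  refine hom_ext_leg hE fun K k => ?_
  rw [← Category.assoc, leg_counit hE k]
  refine Eq.trans ?_ (Category.comp_id _).symm
  -- Only maps that are legs have a known composite with `δ`; `eq_leg` makes `k` one of them.
  conv_lhs => rw [eq_leg hE k]
  exact (leg_comul hE _).trans (congrArg (leg E) (eq_leg hE k).symm)

theorem isIdempotentComonad (hE : E.IsPointwiseLeftKanExtension) :
    IsIdempotentComonad (densityComonad inclusionKHLoc.{u} E hE) := by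
  have := isIso_comul_app hE
  exact NatIso.isIso_of_isIso_app (DensityComonad.comul E hE)

end HLoc

theorem mainTheorem3 :
    inclusionKHLoc.{u}.HasPointwiseLeftKanExtension inclusionKHLoc.{u} ∧
    (∀ (E : inclusionKHLoc.{u}.LeftExtension inclusionKHLoc.{u})
      (hE : E.IsPointwiseLeftKanExtension),
      IsIdempotentComonad (densityComonad inclusionKHLoc.{u} E hE)) ∧
    IsLeftKanExtendable isCompactHLoc.{u} :=
  ⟨HLoc.hasPointwiseLeftKanExtension, fun _ hE => HLoc.isIdempotentComonad hE,
    HLoc.hasPointwiseLeftKanExtension, fun _ hE => HLoc.isIdempotentComonad hE⟩
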